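/- Let $a\in\mathbb{R}$ and $I=[a,\infty]$, and consider functions $f\colon I\to\mathbb{R}$. Then $$\mathcal{LP}(I)\cap\mathcal{BV}(I)=\mathcal{HK}(I)\cap\mathcal{BV}(I).$$ In other words, a function of bounded variation on $I$ is Laplace integrable on $I$ if and only if it is Henstock–Kurzweil integrable on $I$. Here $\mathcal{BV}(I)$ is the set of functions of bounded variation on $I$, and the two notions of integrability are the following. *Laplace integral.* For a continuous $U\colon[\alpha,\beta]\to\mathbb{R}$ the lower right and lower left Laplace derivates at $x$ are $$\liminf_{s\to\infty}s^2\int_0^\delta e^{-st}[U(x+t)-U(x)]\,dt,\qquad \liminf_{s\to\infty}(-s^2)\int_0^\delta e^{-st}[U(x-t)-U(x)]\,dt$$ for $\delta>0$ such that $[x,x+\delta]\subseteq[\alpha,\beta]$, respectively $[x-\delta,x]\subseteq[\alpha,\beta]$ (the values do not depend on $\delta$); the upper derivates are defined with $\limsup$. A continuous $U$ is a major function of $f\colon[\alpha,\beta]\to\mathbb{R}$ if its lower right derivate is $\geq f(x)$ at each $x\in[\alpha,\beta)$ and its lower left derivate is $\geq f(x)$ at each $x\in(\alpha,\beta]$;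 a continuous $V$ is a minor function of $f$ if its upper right, respectively left, derivates are $\leq f(x)$ at these points. The function $f$ is Laplace integrable on $[\alpha,\beta]$ if $\inf_U\,(U(\beta)-U(\alpha))$ over all major functions and $\sup_V\,(V(\beta)-V(\alpha))$ over all minor functions are finite and equal; the common value is $\int_\alpha^\beta f$. Finally, $f\in\mathcal{LP}(I)$ if $f$ is Laplace integrable on $[a,c]$ for every real $c\geq a$ and $\lim_{c\to\infty}\int_a^c f$ exists in $\mathbb{R}$. *Henstock–Kurzweil integral.* $f\in\mathcal{HK}(I)$ if there is $A\in\mathbb{R}$ such that for every $\varepsilon>0$ there is $\gamma\colon[a,\infty]\to(0,\infty)$ with $\left|\sum_{i=1}^{n} f(t_i)(x_i-x_{i-1})-A\right|\leq\varepsilon$ for all $n\geq 0$, all real $a=x_0<x_1<\dots<x_n$ and all $t_i\in[x_{i-1},x_i]$ such that $[x_{i-1},x_i]\subseteq[t_i-\gamma(t_i),t_i+\gamma(t_i)]$ for $1\leq i\leq n$ and $x_n\geq 1/\gamma(\infty)$ (the remaining interval $[x_n,\infty]$, tagged by $\infty$, contributes $0$). -/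

import Mathlib

open Filter Topology Set

noncomputable section

namespace LaplaceIntegral

/-! ### Laplace derivates of a continuous function

The primitives, major and minor functions below are continuous, so the inner integrals are
ordinary integrals of continuous functions. For such functions the values of the four derivates
do not depend on `δ`. -/

/-- Lower right Laplace derivate of `U` at `x`, computed on `[x, x + δ]`. -/
def lowerRight (U : ℝ → ℝ) (x δ : ℝ) : EReal :=
  liminf (fun s : ℝ ↦
    ((s ^ 2 * ∫ t in (0 : ℝ)..δ, Real.exp (-s * t) * (U (x + t) - U x) : ℝ) : EReal)) atTop

/-- Upper right Laplace derivate of `U` at `x`, computed on `[x, x + δ]`. -/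
def upperRight (U : ℝ → ℝ) (x δ : ℝ) : EReal :=
  limsup (fun s : ℝ ↦
    ((s ^ 2 * ∫ t in (0 : ℝ)..δ, Real.exp (-s * t) * (U (x + t) - U x) : ℝ) : EReal)) atTop

/-- Lower left Laplace derivate of `U` at `x`, computed on `[x - δ, x]`. -/
def lowerLeft (U : ℝ → ℝ) (x δ : ℝ) : EReal :=
  liminf (fun s : ℝ ↦
    (((-s ^ 2) * ∫ t in (0 : ℝ)..δ, Real.exp (-s * t) * (U (x - t) - U x) : ℝ) : EReal)) atTop

/-- Upper left Laplace derivate of `U` at `x`, computed on `[x - δ, x]`. -/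
def upperLeft (U : ℝ → ℝ) (x δ : ℝ) : EReal :=
  limsup (fun s : ℝ ↦
    (((-s ^ 2) * ∫ t in (0 : ℝ)..δ, Real.exp (-s * t) * (U (x - t) - U x) : ℝ) : EReal)) atTop

/-! ### The Laplace integral on a compact interval (a Perron-type integral) -/

/-- `U` is a major function of the real-valued `f` on `[a, b]`: it is continuous there and its
lower Laplace derivate (two-sided inside, one-sided at the endpoints) is at least `f` everywhere;
in particular that derivate is nowhere `-∞`. -/
def IsMajor (f U : ℝ → ℝ) (a b : ℝ) : Prop :=
  ContinuousOn U (Icc a b) ∧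
  (∀ x ∈ Ico a b, ∃ δ > 0, x + δ ≤ b ∧ (f x : EReal) ≤ lowerRight U x δ) ∧
  (∀ x ∈ Ioc a b, ∃ δ > 0, a ≤ x - δ ∧ (f x : EReal) ≤ lowerLeft U x δ)

/-- `V` is a minor function of the real-valued `f` on `[a, b]`: it is continuous there and its
upper Laplace derivate is at most `f` everywhere; in particular it is nowhere `+∞`. -/
def IsMinor (f V : ℝ → ℝ) (a b : ℝ) : Prop :=
  ContinuousOn V (Icc a b) ∧
  (∀ x ∈ Ico a b, ∃ δ > 0, x + δ ≤ b ∧ upperRight V x δ ≤ (f x : EReal)) ∧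
  (∀ x ∈ Ioc a b, ∃ δ > 0, a ≤ x - δ ∧ upperLeft V x δ ≤ (f x : EReal))

/-- The increments over `[a, b]` of the major functions of `f`. -/
def majorIncrements (f : ℝ → ℝ) (a b : ℝ) : Set ℝ :=
  {y | ∃ U : ℝ → ℝ, IsMajor f U a b ∧ y = U b - U a}

/-- The increments over `[a, b]` of the minor functions of `f`. -/
def minorIncrements (f : ℝ → ℝ) (a b : ℝ) : Set ℝ :=
  {y | ∃ V : ℝ → ℝ, IsMinor f V a b ∧ y = V b - V a}

/-- `f` is Laplace integrable on `[a, b]`: the infimum of the increments of its major functions and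
the supremum of the increments of its minor functions are finite and equal. (`IsGLB` and `IsLUB`
in `ℝ` force both sets to be nonempty.) -/
def IntegrableOnIcc (f : ℝ → ℝ) (a b : ℝ) : Prop :=
  ∃ A : ℝ, IsGLB (majorIncrements f a b) A ∧ IsLUB (minorIncrements f a b) A

/-- The Laplace integral of `f` over `[a, b]`, meaningful when `IntegrableOnIcc f a b`. -/
def integral (f : ℝ → ℝ) (a b : ℝ) : ℝ := sInf (majorIncrements f a b)

/-! ### The function classes on `[a, ∞]`

A function on `[a, ∞] = Icc (a : EReal) ⊤` is represented by a function on `EReal`; only its values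
on `[a, ∞]` matter in what follows. -/

/-- Laplace integrability on `[a, ∞]`. -/
def LP (a : ℝ) : Set (EReal → ℝ) :=
  {f | (∀ c ≥ a, IntegrableOnIcc (fun x : ℝ ↦ f (x : EReal)) a c) ∧
    ∃ A : ℝ, Tendsto (fun c : ℝ ↦ integral (fun x : ℝ ↦ f (x : EReal)) a c) atTop (𝓝 A)}

/-- Bounded variation on `[a, ∞]`. -/
def BV (a : ℝ) : Set (EReal → ℝ) :=
  {f | BoundedVariationOn f (Icc (a : EReal) ⊤)}

/-- A tagged partition of `[a, ∞]` with finite cells `[point i, point (i + 1)]` tagged by `tag i`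
for `i < n`, and a last cell `[point n, ∞]` tagged by `∞`. (No finite tag can be used for the
last cell of a fine partition, and `∞` can tag no other cell.) -/
structure TaggedPartition (a : ℝ) where
  n : ℕ
  point : ℕ → ℝ
  tag : ℕ → ℝ
  point_zero : point 0 = a
  point_lt : ∀ i < n, point i < point (i + 1)
  tag_mem : ∀ i < n, tag i ∈ Icc (point i) (point (i + 1))

/-- Fineness with respect to a gauge `γ` on `[a, ∞]`: each finite cell with tag `t` lies in
`[t - γ t, t + γ t]`, and the last cell lies in `[1 / γ ∞, ∞]`. -/
def TaggedPartition.IsFine {a : ℝ} (P : TaggedPartition a) (γ : EReal → ℝ) : Prop :=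
  (∀ i < P.n, Icc (P.point i) (P.point (i + 1)) ⊆
    Icc (P.tag i - γ (P.tag i : EReal)) (P.tag i + γ (P.tag i : EReal))) ∧
  1 / γ ⊤ ≤ P.point P.n

/-- The Riemann sum of `f`; by the usual convention the cell tagged by `∞` contributes `0`. -/
def TaggedPartition.riemannSum {a : ℝ} (P : TaggedPartition a) (f : EReal → ℝ) : ℝ :=
  ∑ i ∈ Finset.range P.n, f (P.tag i : EReal) * (P.point (i + 1) - P.point i)

/-- Henstock–Kurzweil integrability on `[a, ∞]`. -/
def HK (a : ℝ) : Set (EReal → ℝ) :=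
  {f | ∃ A : ℝ, ∀ ε > 0, ∃ γ : EReal → ℝ, (∀ x ∈ Icc (a : EReal) ⊤, 0 < γ x) ∧
    ∀ P : TaggedPartition a, P.IsFine γ → |P.riemannSum f - A| ≤ ε}

end LaplaceIntegral

end

namespace LaplaceIntegral

open MeasureTheory

/-! ### Laplace integral over compact intervals -/

/-! A function of bounded variation is a difference of monotone functions, hence Lebesgue integrable
on every `[a, c]`. For such `f`, each kind of integrability on `[a, ∞]` amounts to convergence of
the Lebesgue integrals `∫ x in a..c, f x` as `c → ∞` (`mem_LP_iff`, `mem_HK_iff`).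

On the Laplace side, the integral over `[a, c]` extends the Lebesgue integral: Vitali–Carathéodory
gives major functions with nearly the right increment (`exists_isMajor`), negation gives minor ones,
and no minor increment exceeds a major one (`IsMinor.increment_le`).

On the Henstock–Kurzweil side, a Riemann sum of mesh `η` differs from the integral over its finite
cells by at most `η` times the total variation, uniformly in the right endpoint. Only the behaviour
at `∞` remains. -/

/-- The truncated Laplace quotient of an increment function `φ`. -/
noncomputable def laplaceQuotient (φ : ℝ → ℝ) (δ s : ℝ) : ℝ :=
  s ^ 2 * ∫ t in (0 : ℝ)..δ, Real.exp (-s * t) * φ t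

/-! ### Asymptotics of the Laplace quotient -/

theorem intervalIntegrable_exp_mul {φ : ℝ → ℝ} {u v : ℝ} (hφ : ContinuousOn φ (Icc u v))
    (huv : u ≤ v) (s : ℝ) :
    IntervalIntegrable (fun t ↦ Real.exp (-s * t) * φ t) volume u v := by
  apply ContinuousOn.intervalIntegrable
  rw [uIcc_of_le huv]
  exact (by fun_prop : Continuous fun t : ℝ ↦ Real.exp (-s * t)).continuousOn.mul hφ

theorem laplaceQuotient_mono {φ ψ : ℝ → ℝ} {δ : ℝ} (hδ : 0 ≤ δ) (hφ : ContinuousOn φ (Icc 0 δ))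
    (hψ : ContinuousOn ψ (Icc 0 δ)) (h : ∀ t ∈ Icc 0 δ, φ t ≤ ψ t) (s : ℝ) :
    laplaceQuotient φ δ s ≤ laplaceQuotient ψ δ s := by
  refine mul_le_mul_of_nonneg_left ?_ (sq_nonneg s)
  refine intervalIntegral.integral_mono_on hδ (intervalIntegrable_exp_mul hφ hδ s)
    (intervalIntegrable_exp_mul hψ hδ s) fun t ht ↦ ?_
  exact mul_le_mul_of_nonneg_left (h t ht) (Real.exp_pos _).le

theorem laplaceQuotient_sub {φ ψ : ℝ → ℝ} {δ : ℝ} (hδ : 0 ≤ δ) (hφ : ContinuousOn φ (Icc 0 δ))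
    (hψ : ContinuousOn ψ (Icc 0 δ)) (s : ℝ) :
    laplaceQuotient (fun t ↦ φ t - ψ t) δ s = laplaceQuotient φ δ s - laplaceQuotient ψ δ s := by
  simp only [laplaceQuotient, mul_sub]
  rw [intervalIntegral.integral_sub (intervalIntegrable_exp_mul hφ hδ s)
    (intervalIntegrable_exp_mul hψ hδ s), mul_sub]

theorem laplaceQuotient_const_mul (c : ℝ) (φ : ℝ → ℝ) (δ s : ℝ) :
    laplaceQuotient (fun t ↦ c * φ t) δ s = c * laplaceQuotient φ δ s := by
  simp only [laplaceQuotient, mul_left_comm _ c, intervalIntegral.integral_const_mul]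

theorem laplaceQuotient_neg (φ : ℝ → ℝ) (δ s : ℝ) :
    laplaceQuotient (fun t ↦ -φ t) δ s = -laplaceQuotient φ δ s := by
  simpa using laplaceQuotient_const_mul (-1) φ δ s

theorem tendsto_pow_mul_exp_neg_mul (n : ℕ) {δ : ℝ} (hδ : 0 < δ) :
    Tendsto (fun s : ℝ ↦ s ^ n * Real.exp (-s * δ)) atTop (𝓝 0) := by
  have h := ((Real.tendsto_pow_mul_exp_neg_atTop_nhds_zero n).comp
    (tendsto_id.atTop_mul_const hδ)).const_mul ((δ ^ n)⁻¹)
  rw [mul_zero] at h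
  refine h.congr fun s ↦ ?_
  have : δ ^ n ≠ 0 := (pow_pos hδ n).ne'
  simp only [Function.comp_apply, id_eq, mul_pow, neg_mul]
  field_simp

theorem tendsto_laplaceQuotient_id {δ : ℝ} (hδ : 0 < δ) :
    Tendsto (laplaceQuotient (fun t ↦ t) δ) atTop (𝓝 1) := by
  -- This is the exact value of the quotient for `s > 0`, found by integrating by parts.
  have h : Tendsto (fun s : ℝ ↦ 1 - s ^ 0 * Real.exp (-s * δ) -
      δ * (s ^ 1 * Real.exp (-s * δ))) atTop (𝓝 (1 - 0 - δ * 0)) :=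
    ((tendsto_pow_mul_exp_neg_mul 0 hδ).const_sub 1).sub
      ((tendsto_pow_mul_exp_neg_mul 1 hδ).const_mul δ)
  simp only [sub_zero, mul_zero] at h
  refine h.congr' ?_
  filter_upwards [eventually_gt_atTop 0] with s hs
  have hd : ∀ t ∈ uIcc 0 δ, HasDerivAt (fun t ↦ -(Real.exp (-s * t) * (s * t + 1)) / s ^ 2)
      (Real.exp (-s * t) * t) t := by
    intro t _
    have h1 : HasDerivAt (fun t ↦ Real.exp (-s * t)) (Real.exp (-s * t) * (-s * 1)) t :=
      ((hasDerivAt_id t).const_mul (-s)).exp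
    have h2 : HasDerivAt (fun t ↦ s * t + 1) (s * 1) t :=
      ((hasDerivAt_id t).const_mul s).add_const 1
    refine ((h1.mul h2).neg.div_const (s ^ 2)).congr_deriv ?_
    field_simp
    ring
  rw [laplaceQuotient, intervalIntegral.integral_eq_sub_of_hasDerivAt hd
    (intervalIntegrable_exp_mul continuousOn_id hδ.le s)]
  have : s ≠ 0 := hs.ne'
  simp only [mul_zero, Real.exp_zero]
  field_simp
  ring

/-- The part of the integral over `[δ₁, δ₂]` is `O(exp (-s * δ₁))`, which beats `s ^ 2`. Hence
derivates do not depend on `δ`. -/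
theorem tendsto_laplaceQuotient_sub_of_le {φ : ℝ → ℝ} {δ₁ δ₂ : ℝ} (h₁ : 0 < δ₁) (h : δ₁ ≤ δ₂)
    (hφ : ContinuousOn φ (Icc 0 δ₂)) :
    Tendsto (fun s ↦ laplaceQuotient φ δ₂ s - laplaceQuotient φ δ₁ s) atTop (𝓝 0) := by
  obtain ⟨M, hM⟩ := isCompact_Icc.exists_bound_of_continuousOn hφ
  have hlim := (tendsto_pow_mul_exp_neg_mul 2 h₁).mul_const (M * (δ₂ - δ₁))
  rw [zero_mul] at hlim
  refine squeeze_zero_norm' ?_ hlim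
  filter_upwards [eventually_gt_atTop 0] with s hs
  have hi₁ := intervalIntegrable_exp_mul (hφ.mono (Icc_subset_Icc_right h)) h₁.le s
  have hi₂ := intervalIntegrable_exp_mul (hφ.mono (Icc_subset_Icc_left h₁.le)) h s
  rw [laplaceQuotient, laplaceQuotient, ← mul_sub,
    ← intervalIntegral.integral_add_adjacent_intervals hi₁ hi₂, add_sub_cancel_left, norm_mul,
    mul_assoc, Real.norm_of_nonneg (sq_nonneg s)]
  refine mul_le_mul_of_nonneg_left ?_ (sq_nonneg s)
  have hb := intervalIntegral.norm_integral_le_of_norm_le_const (a := δ₁) (b := δ₂)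
    (f := fun t ↦ Real.exp (-s * t) * φ t) (C := Real.exp (-s * δ₁) * M) ?_
  · rwa [abs_of_nonneg (sub_nonneg.2 h), mul_assoc] at hb
  · intro t ht
    rw [uIoc_of_le h] at ht
    rw [norm_mul, Real.norm_of_nonneg (Real.exp_pos _).le]
    refine mul_le_mul (Real.exp_le_exp.2 ?_) (hM t ⟨h₁.le.trans ht.1.le, ht.2⟩) (norm_nonneg _)
      (Real.exp_pos _).le
    nlinarith [ht.1]

theorem le_liminf_laplaceQuotient {φ : ℝ → ℝ} {δ c : ℝ} (hδ : 0 < δ)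
    (hφ : ContinuousOn φ (Icc 0 δ)) (h : ∀ t ∈ Icc 0 δ, c * t ≤ φ t) :
    (c : EReal) ≤ liminf (fun s ↦ (laplaceQuotient φ δ s : EReal)) atTop := by
  have h1 : Tendsto (fun s ↦ ((c * laplaceQuotient (fun t ↦ t) δ s : ℝ) : EReal)) atTop
      (𝓝 (c : EReal)) := by
    refine (continuous_coe_real_ereal.tendsto c).comp ?_
    simpa using (tendsto_laplaceQuotient_id hδ).const_mul c
  rw [← h1.liminf_eq]
  refine liminf_le_liminf (Eventually.of_forall fun s ↦ EReal.coe_le_coe_iff.2 ?_)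
  rw [← laplaceQuotient_const_mul]
  exact laplaceQuotient_mono hδ.le (by fun_prop) hφ h s

/-! ### Derivates, major and minor functions -/

theorem lowerRight_eq (U : ℝ → ℝ) (x δ : ℝ) : lowerRight U x δ =
    liminf (fun s ↦ (laplaceQuotient (fun t ↦ U (x + t) - U x) δ s : EReal)) atTop := rfl

theorem upperRight_eq (U : ℝ → ℝ) (x δ : ℝ) : upperRight U x δ =
    limsup (fun s ↦ (laplaceQuotient (fun t ↦ U (x + t) - U x) δ s : EReal)) atTop := rfl

theorem lowerLeft_eq (U : ℝ → ℝ) (x δ : ℝ) : lowerLeft U x δ =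
    liminf (fun s ↦ (laplaceQuotient (fun t ↦ U x - U (x - t)) δ s : EReal)) atTop := by
  have (s : ℝ) : laplaceQuotient (fun t ↦ U x - U (x - t)) δ s =
      -laplaceQuotient (fun t ↦ U (x - t) - U x) δ s := by
    rw [← laplaceQuotient_neg]; simp only [neg_sub]
  simp only [this, lowerLeft]
  simp only [laplaceQuotient, neg_mul]

theorem upperRight_neg (U : ℝ → ℝ) (x δ : ℝ) :
    upperRight (fun y ↦ -U y) x δ = -lowerRight U x δ := by
  have (s : ℝ) : laplaceQuotient (fun t ↦ -U (x + t) - -U x) δ s =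
      -laplaceQuotient (fun t ↦ U (x + t) - U x) δ s := by
    rw [← laplaceQuotient_neg]; congr 1; ext t; ring
  simp only [upperRight_eq, lowerRight_eq, this, EReal.coe_neg]
  exact EReal.limsup_neg

theorem upperLeft_neg (U : ℝ → ℝ) (x δ : ℝ) :
    upperLeft (fun y ↦ -U y) x δ = -lowerLeft U x δ := by
  have (s : ℝ) : -s ^ 2 * ∫ t in (0 : ℝ)..δ, Real.exp (-s * t) * (-U (x - t) - -U x) =
      -(-s ^ 2 * ∫ t in (0 : ℝ)..δ, Real.exp (-s * t) * (U (x - t) - U x)) := by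
    rw [← mul_neg, ← intervalIntegral.integral_neg]
    congr 2; ext t; ring
  simp only [upperLeft, lowerLeft, this, EReal.coe_neg]
  exact EReal.limsup_neg

theorem IsMajor.isMinor_neg {f U : ℝ → ℝ} {a b : ℝ} (h : IsMajor (fun x ↦ -f x) U a b) :
    IsMinor f (fun x ↦ -U x) a b := by
  refine ⟨h.1.neg, fun x hx ↦ ?_, fun x hx ↦ ?_⟩
  · obtain ⟨δ, hδ, hb, hle⟩ := h.2.1 x hx
    refine ⟨δ, hδ, hb, ?_⟩
    rw [upperRight_neg, EReal.neg_le]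
    exact_mod_cast hle
  · obtain ⟨δ, hδ, hb, hle⟩ := h.2.2 x hx
    refine ⟨δ, hδ, hb, ?_⟩
    rw [upperLeft_neg, EReal.neg_le]
    exact_mod_cast hle

/-- Replaces the unspecified `δ` by the common length `b - x`, so that a major and a minor function
can be compared at the same `s`. -/
theorem IsMajor.eventually_lt {f U : ℝ → ℝ} {a b x r : ℝ} (h : IsMajor f U a b)
    (hx : x ∈ Ico a b) (hr : r < f x) :
    ∀ᶠ s in atTop, r < laplaceQuotient (fun t ↦ U (x + t) - U x) (b - x) s := by
  obtain ⟨δ, hδ, hb, hle⟩ := h.2.1 x hx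
  have hc : ContinuousOn (fun t ↦ U (x + t) - U x) (Icc 0 (b - x)) :=
    (h.1.comp (by fun_prop) fun t ht ↦
      ⟨by linarith [hx.1, ht.1], by linarith [ht.2]⟩).sub continuousOn_const
  have h0 := tendsto_laplaceQuotient_sub_of_le hδ (le_sub_iff_add_le'.2 hb) hc
  have h1 : ((((r + f x) / 2 : ℝ)) : EReal) < lowerRight U x δ :=
    (EReal.coe_lt_coe_iff.2 (by linarith)).trans_le hle
  filter_upwards [eventually_lt_of_lt_liminf h1,
    h0.eventually (lt_mem_nhds (show -((f x - r) / 2) < 0 by linarith))] with s hs₁ hs₂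
  have hs₁' : (r + f x) / 2 < laplaceQuotient (fun t ↦ U (x + t) - U x) δ s :=
    EReal.coe_lt_coe_iff.1 hs₁
  linarith

theorem IsMinor.eventually_lt {f V : ℝ → ℝ} {a b x r : ℝ} (h : IsMinor f V a b)
    (hx : x ∈ Ico a b) (hr : f x < r) :
    ∀ᶠ s in atTop, laplaceQuotient (fun t ↦ V (x + t) - V x) (b - x) s < r := by
  obtain ⟨δ, hδ, hb, hle⟩ := h.2.1 x hx
  have hc : ContinuousOn (fun t ↦ V (x + t) - V x) (Icc 0 (b - x)) :=
    (h.1.comp (by fun_prop) fun t ht ↦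
      ⟨by linarith [hx.1, ht.1], by linarith [ht.2]⟩).sub continuousOn_const
  have h0 := tendsto_laplaceQuotient_sub_of_le hδ (le_sub_iff_add_le'.2 hb) hc
  have h1 : upperRight V x δ < ((((r + f x) / 2 : ℝ)) : EReal) :=
    hle.trans_lt (EReal.coe_lt_coe_iff.2 (by linarith))
  filter_upwards [eventually_lt_of_limsup_lt h1,
    h0.eventually (gt_mem_nhds (show 0 < (r - f x) / 2 by linarith))] with s hs₁ hs₂
  have hs₁' : laplaceQuotient (fun t ↦ V (x + t) - V x) δ s < (r + f x) / 2 :=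
    EReal.coe_lt_coe_iff.1 hs₁
  linarith

/-- If a continuous function decreases from `a` to `b`, then some point of `[a, b)` has a value
strictly above all later values. -/
theorem exists_forall_lt_of_lt {W : ℝ → ℝ} {a b : ℝ} (hab : a ≤ b)
    (hW : ContinuousOn W (Icc a b)) (h : W b < W a) :
    ∃ x ∈ Ico a b, ∀ y ∈ Ioc x b, W y < W x := by
  -- The midlevel lies strictly between `W b` and `W a`, so the last point at or above it exists and
  -- is not `b`.
  set S := Icc a b ∩ W ⁻¹' Ici ((W a + W b) / 2)
  have hS : IsCompact S :=
    isCompact_Icc.of_isClosed_subset (hW.preimage_isClosed_of_isClosed isClosed_Icc isClosed_Ici)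
      inter_subset_left
  obtain ⟨x, hxS, hx⟩ := hS.exists_isGreatest ⟨a, left_mem_Icc.2 hab, by
    simp only [mem_preimage, mem_Ici]; linarith⟩
  have hxm : (W a + W b) / 2 ≤ W x := hxS.2
  refine ⟨x, ⟨hxS.1.1, lt_of_le_of_ne hxS.1.2 ?_⟩, fun y hy ↦ ?_⟩
  · rintro rfl
    linarith
  · by_contra! hlt
    exact (hx ⟨⟨hxS.1.1.trans hy.1.le, hy.2⟩, hxm.trans hlt⟩).not_gt hy.1

/-- Otherwise `U - V` plus a small slope `η` still decreases overall, so at some `x` it exceeds all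
its later values. Integrating against the Laplace kernel there contradicts the derivate bounds at
`x`; only right derivates are needed. -/
theorem IsMinor.increment_le {f U V : ℝ → ℝ} {a b : ℝ} (hab : a ≤ b) (hV : IsMinor f V a b)
    (hU : IsMajor f U a b) : V b - V a ≤ U b - U a := by
  refine le_of_forall_pos_le_add fun ε hε ↦ ?_
  by_contra! hlt
  set η := ε / (b - a + 1)
  have hη : 0 < η := div_pos hε (by linarith)
  have hηε : η * (b - a) ≤ ε := by
    rw [div_mul_eq_mul_div, div_le_iff₀ (by linarith)]
    nlinarith
  obtain ⟨x, hx, hlt⟩ := exists_forall_lt_of_lt (W := fun y ↦ U y - V y + η * y) hab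
    ((hU.1.sub hV.1).add (by fun_prop)) (by linarith)
  have hcU : ContinuousOn (fun t ↦ U (x + t) - U x) (Icc 0 (b - x)) :=
    (hU.1.comp (by fun_prop) fun t ht ↦
      ⟨by linarith [hx.1, ht.1], by linarith [ht.2]⟩).sub continuousOn_const
  have hcV : ContinuousOn (fun t ↦ V (x + t) - V x) (Icc 0 (b - x)) :=
    (hV.1.comp (by fun_prop) fun t ht ↦
      ⟨by linarith [hx.1, ht.1], by linarith [ht.2]⟩).sub continuousOn_const
  have hbx : 0 < b - x := sub_pos.2 hx.2
  obtain ⟨s, h1, h2, h3⟩ := ((hU.eventually_lt hx (show f x - η / 4 < f x by linarith)).and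
    ((hV.eventually_lt hx (show f x < f x + η / 4 by linarith)).and
      ((tendsto_laplaceQuotient_id hbx).eventually
        (lt_mem_nhds (show (1 / 2 : ℝ) < 1 by norm_num))))).exists
  have hcη : ContinuousOn (fun t ↦ η * t) (Icc 0 (b - x)) := by fun_prop
  have h4 := laplaceQuotient_mono hbx.le hcU (hcV.sub hcη) (fun t ht ↦ ?_) s
  · have h5 := laplaceQuotient_sub hbx.le hcV hcη s
    have h6 := laplaceQuotient_const_mul η (fun t ↦ t) (b - x) s
    -- Contradiction: `f x - η / 4 < Q U ≤ Q V - η * Q id < f x + η / 4 - η / 2`, with `Q` the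
    -- quotient at `s`.
    have h7 := h4.trans_eq (h5.trans (congrArg _ h6))
    nlinarith
  · rcases ht.1.eq_or_lt with rfl | ht0
    · simp
    · have := hlt (x + t) ⟨by linarith, by linarith [ht.2]⟩
      simp only [Pi.sub_apply]
      linarith

/-- Major functions approximating the Lebesgue integral, from the Vitali–Carathéodory theorem. -/
theorem exists_isMajor {f : ℝ → ℝ} {a b ε : ℝ} (hab : a ≤ b) (hf : IntegrableOn f (Icc a b))
    (hε : 0 < ε) : ∃ U, IsMajor f U a b ∧ U b - U a ≤ (∫ x in a..b, f x) + ε := by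
  obtain ⟨g, hfg, hg, hgi, hgt, hgint⟩ := exists_lt_lowerSemicontinuous_integral_lt f hf hε
  set G := fun x ↦ (g x).toReal
  have hGi : ∀ {u v}, u ∈ Icc a b → v ∈ Icc a b → IntervalIntegrable G volume u v := by
    intro u v hu hv
    refine (IntegrableOn.mono_set hgi (uIcc_subset_Icc hu hv)).intervalIntegrable
  have ha : a ∈ Icc a b := left_mem_Icc.2 hab
  have hcont : ContinuousOn (fun x ↦ ∫ t in a..x, G t) (Icc a b) := by
    have := intervalIntegral.continuousOn_primitive_interval (a := a) (b := b) (f := G)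
      (μ := volume) (by rwa [uIcc_of_le hab])
    rwa [uIcc_of_le hab] at this
  have hnear : ∀ x, ∃ r > 0, ∀ u v, u ∈ Icc a b → v ∈ Icc a b → u ≤ v → x - r ≤ u → v ≤ x + r →
      f x * (v - u) ≤ ∫ t in u..v, G t := by
    intro x
    -- Lower semicontinuity keeps `g` above the number `f x` near `x`, so the primitive of `g` has
    -- slope at least `f x` there.
    obtain ⟨r, hr, hball⟩ := Metric.eventually_nhds_iff.1 (hg x (f x) (hfg x))
    refine ⟨r / 2, by positivity, fun u v hu hv huv hxu hvx ↦ ?_⟩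
    have hc : ∫ t in u..v, f x = f x * (v - u) := by simp [mul_comm]
    rw [← hc]
    refine intervalIntegral.integral_mono_ae_restrict huv intervalIntegrable_const (hGi hu hv) ?_
    have hgt' := ae_restrict_of_ae_restrict_of_subset (Icc_subset_Icc hu.1 hv.2) hgt
    filter_upwards [hgt', ae_restrict_mem measurableSet_Icc] with y hy hyuv
    have hy' : (f x : EReal) < g y := hball (by
      rw [Real.dist_eq, abs_lt]; constructor <;> linarith [hyuv.1, hyuv.2])
    rw [← EReal.coe_le_coe_iff, EReal.coe_toReal hy.ne (bot_le.trans_lt hy').ne']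
    exact hy'.le
  have hinc : ∀ {u v}, u ∈ Icc a b → v ∈ Icc a b →
      (∫ t in a..v, G t) - ∫ t in a..u, G t = ∫ t in u..v, G t := fun hu hv ↦
    intervalIntegral.integral_interval_sub_left (hGi ha hv) (hGi ha hu)
  refine ⟨fun x ↦ ∫ t in a..x, G t, ⟨hcont, fun x hx ↦ ?_, fun x hx ↦ ?_⟩, ?_⟩
  · obtain ⟨r, hr, h⟩ := hnear x
    have hδ : 0 < min r (b - x) := lt_min hr (sub_pos.2 hx.2)
    refine ⟨min r (b - x), hδ, by linarith [min_le_right r (b - x)], ?_⟩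
    have hmem : ∀ t ∈ Icc 0 (min r (b - x)), x + t ∈ Icc a b := fun t ht ↦
      ⟨by linarith [hx.1, ht.1], by linarith [ht.2, min_le_right r (b - x)]⟩
    rw [lowerRight_eq]
    refine le_liminf_laplaceQuotient hδ
      ((hcont.comp (by fun_prop) hmem).sub continuousOn_const) fun t ht ↦ ?_
    have := h x (x + t) (Ico_subset_Icc_self hx) (hmem t ht) (by linarith [ht.1]) (by linarith)
      (by linarith [ht.2, min_le_left r (b - x)])
    rw [hinc (Ico_subset_Icc_self hx) (hmem t ht)]
    simpa using this
  · obtain ⟨r, hr, h⟩ := hnear x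
    have hδ : 0 < min r (x - a) := lt_min hr (sub_pos.2 hx.1)
    refine ⟨min r (x - a), hδ, by linarith [min_le_right r (x - a)], ?_⟩
    have hmem : ∀ t ∈ Icc 0 (min r (x - a)), x - t ∈ Icc a b := fun t ht ↦
      ⟨by linarith [ht.2, min_le_right r (x - a)], by linarith [hx.2, ht.1]⟩
    rw [lowerLeft_eq]
    refine le_liminf_laplaceQuotient hδ
      (continuousOn_const.sub (hcont.comp (by fun_prop) hmem)) fun t ht ↦ ?_
    have := h (x - t) x (hmem t ht) (Ioc_subset_Icc_self hx) (by linarith [ht.1])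
      (by linarith [ht.2, min_le_left r (x - a)]) (by linarith)
    rw [hinc (hmem t ht) (Ioc_subset_Icc_self hx)]
    simpa using this
  · simp only [intervalIntegral.integral_same, sub_zero]
    rw [intervalIntegral.integral_of_le hab, intervalIntegral.integral_of_le hab,
      ← integral_Icc_eq_integral_Ioc, ← integral_Icc_eq_integral_Ioc]
    exact hgint.le

theorem exists_isMinor {f : ℝ → ℝ} {a b ε : ℝ} (hab : a ≤ b) (hf : IntegrableOn f (Icc a b))
    (hε : 0 < ε) : ∃ V, IsMinor f V a b ∧ (∫ x in a..b, f x) - ε ≤ V b - V a := by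
  obtain ⟨U, hU, hle⟩ := exists_isMajor hab hf.neg hε
  refine ⟨_, hU.isMinor_neg, ?_⟩
  simp only [Pi.neg_apply, intervalIntegral.integral_neg] at hle
  linarith

/-! ### Agreement with the Lebesgue integral -/

theorem isGLB_majorIncrements {f : ℝ → ℝ} {a b : ℝ} (hab : a ≤ b)
    (hf : IntegrableOn f (Icc a b)) : IsGLB (majorIncrements f a b) (∫ x in a..b, f x) := by
  constructor
  · rintro _ ⟨U, hU, rfl⟩
    refine le_of_forall_pos_le_add fun ε hε ↦ ?_
    obtain ⟨V, hV, hle⟩ := exists_isMinor hab hf hε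
    linarith [hV.increment_le hab hU]
  · intro y hy
    refine le_of_forall_pos_le_add fun ε hε ↦ ?_
    obtain ⟨U, hU, hle⟩ := exists_isMajor hab hf hε
    exact (hy ⟨U, hU, rfl⟩).trans hle

theorem isLUB_minorIncrements {f : ℝ → ℝ} {a b : ℝ} (hab : a ≤ b)
    (hf : IntegrableOn f (Icc a b)) : IsLUB (minorIncrements f a b) (∫ x in a..b, f x) := by
  constructor
  · rintro _ ⟨V, hV, rfl⟩
    refine le_of_forall_pos_le_add fun ε hε ↦ ?_
    obtain ⟨U, hU, hle⟩ := exists_isMajor hab hf hε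
    linarith [hV.increment_le hab hU]
  · intro y hy
    refine le_of_forall_pos_le_add fun ε hε ↦ ?_
    obtain ⟨V, hV, hle⟩ := exists_isMinor hab hf hε
    linarith [hy ⟨V, hV, rfl⟩]

theorem integrableOnIcc_of_integrableOn {f : ℝ → ℝ} {a b : ℝ} (hab : a ≤ b)
    (hf : IntegrableOn f (Icc a b)) : IntegrableOnIcc f a b :=
  ⟨_, isGLB_majorIncrements hab hf, isLUB_minorIncrements hab hf⟩

theorem integral_eq_of_integrableOn {f : ℝ → ℝ} {a b : ℝ} (hab : a ≤ b)
    (hf : IntegrableOn f (Icc a b)) : integral f a b = ∫ x in a..b, f x :=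
  (isGLB_majorIncrements hab hf).csInf_eq
    (let ⟨U, hU, _⟩ := exists_isMajor hab hf one_pos; ⟨_, U, hU, rfl⟩)

/-! ### Riemann sums and tagged partitions -/

theorem integrableOn_of_boundedVariationOn {g : ℝ → ℝ} {a c : ℝ}
    (hg : BoundedVariationOn g (Ici a)) : IntegrableOn g (Icc a c) := by
  obtain ⟨p, q, hp, hq, rfl⟩ := hg.locallyBoundedVariationOn.exists_monotoneOn_sub_monotoneOn
  exact ((hp.mono Icc_subset_Ici_self).integrableOn_isCompact isCompact_Icc).sub
    ((hq.mono Icc_subset_Ici_self).integrableOn_isCompact isCompact_Icc)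

theorem intervalIntegrable_of_boundedVariationOn {g : ℝ → ℝ} {a u v : ℝ}
    (hg : BoundedVariationOn g (Ici a)) (hu : a ≤ u) (hv : a ≤ v) :
    IntervalIntegrable g volume u v :=
  ((integrableOn_of_boundedVariationOn hg).mono_set
    (uIcc_subset_Icc ⟨hu, le_max_left u v⟩ ⟨hv, le_max_right u v⟩)).intervalIntegrable

theorem boundedVariationOn_comp_coe {f : EReal → ℝ} {a : ℝ} (hf : f ∈ BV a) :
    BoundedVariationOn (fun x : ℝ ↦ f x) (Ici a) :=
  ne_top_of_le_ne_top hf (eVariationOn.comp_le_of_monotoneOn f (fun x : ℝ ↦ (x : EReal))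
    (fun _ _ _ _ h ↦ EReal.coe_le_coe_iff.2 h) fun _ hx ↦ ⟨EReal.coe_le_coe_iff.2 hx, le_top⟩)

/-- On the cell, `g` differs from `g t` by at most its variation over the cell; integrate this
bound. -/
theorem abs_mul_sub_integral_le {g : ℝ → ℝ} {a u v t : ℝ} (hg : BoundedVariationOn g (Ici a))
    (hu : a ≤ u) (ht : t ∈ Icc u v) :
    |g t * (v - u) - ∫ x in u..v, g x| ≤
      (variationOnFromTo g (Ici a) a v - variationOnFromTo g (Ici a) a u) * (v - u) := by
  have hl := hg.locallyBoundedVariationOn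
  have huv : u ≤ v := ht.1.trans ht.2
  have hmono := variationOnFromTo.monotoneOn hl (self_mem_Ici (a := a))
  have key : ∀ x y, u ≤ x → x ≤ y → y ≤ v → |g y - g x| ≤
      variationOnFromTo g (Ici a) a v - variationOnFromTo g (Ici a) a u := by
    intro x y hux hxy hyv
    have hx : a ≤ x := hu.trans hux
    refine (variationOnFromTo.abs_sub_le_sub_of_le hl self_mem_Ici hx (hx.trans hxy) hxy).trans ?_
    exact sub_le_sub (hmono (hx.trans hxy) (hu.trans huv) hyv) (hmono hu hx hux)
  have hc : g t * (v - u) = ∫ _ in u..v, g t := by simp [mul_comm]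
  rw [hc, ← intervalIntegral.integral_sub intervalIntegrable_const
    (intervalIntegrable_of_boundedVariationOn hg hu (hu.trans huv))]
  have := intervalIntegral.norm_integral_le_of_norm_le_const (a := u) (b := v)
    (f := fun x ↦ g t - g x)
    (C := variationOnFromTo g (Ici a) a v - variationOnFromTo g (Ici a) a u) fun x hx ↦ ?_
  · rwa [abs_of_nonneg (sub_nonneg.2 huv)] at this
  · rw [uIoc_of_le huv] at hx
    rcases le_total x t with h | h
    · exact key x t hx.1.le h ht.2
    · rw [norm_sub_rev]
      exact key t x ht.1 h hx.2

namespace TaggedPartition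

variable {a : ℝ}

theorem le_point (P : TaggedPartition a) : ∀ i ≤ P.n, a ≤ P.point i
  | 0, _ => P.point_zero.ge
  | i + 1, hi => (P.le_point i (by omega)).trans (P.point_lt i (by omega)).le

/-- The variations over the cells telescope. -/
theorem abs_riemannSum_sub_integral_le (P : TaggedPartition a) {f : EReal → ℝ} (hf : f ∈ BV a)
    {η : ℝ} (hη : 0 ≤ η) (hP : ∀ i < P.n, P.point (i + 1) - P.point i ≤ η) :
    |P.riemannSum f - ∫ x in a..P.point P.n, f (x : EReal)| ≤
      η * (eVariationOn (fun x : ℝ ↦ f x) (Ici a)).toReal := by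
  set g : ℝ → ℝ := fun x ↦ f x
  have hg : BoundedVariationOn g (Ici a) := boundedVariationOn_comp_coe hf
  set w := fun i ↦ variationOnFromTo g (Ici a) a (P.point i)
  have hint : ∑ i ∈ Finset.range P.n, ∫ x in P.point i..P.point (i + 1), g x =
      ∫ x in P.point 0..P.point P.n, g x :=
    intervalIntegral.sum_integral_adjacent_intervals fun i hi ↦
      intervalIntegrable_of_boundedVariationOn hg (P.le_point i hi.le) (P.le_point (i + 1) hi)
  rw [P.point_zero] at hint
  rw [riemannSum, ← hint, ← Finset.sum_sub_distrib]
  calc _ ≤ ∑ i ∈ Finset.range P.n, (w (i + 1) - w i) * η := by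
        refine (Finset.abs_sum_le_sum_abs _ _).trans (Finset.sum_le_sum fun i hi ↦ ?_)
        have hi := Finset.mem_range.1 hi
        refine (abs_mul_sub_integral_le hg (P.le_point i hi.le) (P.tag_mem i hi)).trans
          (mul_le_mul_of_nonneg_left (hP i hi) (sub_nonneg.2 ?_))
        exact variationOnFromTo.monotoneOn hg.locallyBoundedVariationOn self_mem_Ici
          (P.le_point i hi.le) (P.le_point (i + 1) hi) (P.point_lt i hi).le
    _ = η * w P.n := by
        rw [← Finset.sum_mul, Finset.sum_range_sub, mul_comm]
        simp [w, P.point_zero, variationOnFromTo.self]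
    _ ≤ _ := mul_le_mul_of_nonneg_left
        ((le_abs_self _).trans (variationOnFromTo.abs_le_eVariationOn hg)) hη

/-- The cells of `P` are fine with respect to the gauge `γ` on the real line. -/
def CellsFine (P : TaggedPartition a) (γ : ℝ → ℝ) : Prop :=
  ∀ i < P.n, Icc (P.point i) (P.point (i + 1)) ⊆
    Icc (P.tag i - γ (P.tag i)) (P.tag i + γ (P.tag i))

theorem CellsFine.length_le {P : TaggedPartition a} {γ : ℝ → ℝ} (hP : P.CellsFine γ) {η : ℝ}
    (hγ : ∀ x, a ≤ x → γ x ≤ η) (i : ℕ) (hi : i < P.n) :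
    P.point (i + 1) - P.point i ≤ 2 * η := by
  have hlt := (P.point_lt i hi).le
  have h1 := (hP i hi (left_mem_Icc.2 hlt)).1
  have h2 := (hP i hi (right_mem_Icc.2 hlt)).2
  have h3 := hγ (P.tag i) ((P.le_point i hi.le).trans (P.tag_mem i hi).1)
  linarith

theorem exists_snoc (P : TaggedPartition a) {γ : ℝ → ℝ} (hP : P.CellsFine γ) {t v : ℝ}
    (hv : P.point P.n < v) (ht : t ∈ Icc (P.point P.n) v)
    (hγ : Icc (P.point P.n) v ⊆ Icc (t - γ t) (t + γ t)) :
    ∃ Q : TaggedPartition a, Q.CellsFine γ ∧ Q.point Q.n = v := by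
  refine ⟨⟨P.n + 1, fun i ↦ if i ≤ P.n then P.point i else v,
    fun i ↦ if i < P.n then P.tag i else t, by simp [P.point_zero], ?_, ?_⟩, ?_, by simp⟩
  all_goals
    intro i hi
    rcases (Nat.lt_succ_iff.1 hi).eq_or_lt with rfl | h
    · simpa
  · simpa [h.le, Nat.succ_le_of_lt h] using P.point_lt i h
  · simpa only [h, h.le, Nat.succ_le_of_lt h, if_true] using P.tag_mem i h
  · simpa only [h, h.le, Nat.succ_le_of_lt h, if_true] using hP i h

/-- Cousin's lemma. -/
theorem exists_cellsFine {γ : ℝ → ℝ} {c : ℝ} (hac : a ≤ c) (hγ : ∀ x, a ≤ x → 0 < γ x) :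
    ∃ P : TaggedPartition a, P.CellsFine γ ∧ P.point P.n = c := by
  set S := {x | x ≤ c ∧ ∃ P : TaggedPartition a, P.CellsFine γ ∧ P.point P.n = x}
  have haS : a ∈ S := ⟨hac, ⟨0, fun _ ↦ a, fun _ ↦ a, rfl, by simp, by simp⟩,
    fun i hi ↦ absurd hi (Nat.not_lt_zero i), rfl⟩
  have hbdd : BddAbove S := ⟨c, fun x hx ↦ hx.1⟩
  set s := sSup S
  have has : a ≤ s := le_csSup hbdd haS
  have hsc : s ≤ c := csSup_le ⟨a, haS⟩ fun x hx ↦ hx.1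
  have hγs := hγ s has
  have hsS : ∃ P : TaggedPartition a, P.CellsFine γ ∧ P.point P.n = s := by
    -- A partition ending within `γ s` of the supremum `s` reaches `s` by one more cell tagged `s`.
    obtain ⟨d, ⟨hdc, P, hP, rfl⟩, hd⟩ := exists_lt_of_lt_csSup ⟨a, haS⟩ (sub_lt_self s hγs)
    rcases (le_csSup hbdd (show P.point P.n ∈ S from ⟨hdc, P, hP, rfl⟩)).eq_or_lt with h | h
    · exact ⟨P, hP, h⟩
    · exact P.exists_snoc hP h (right_mem_Icc.2 h.le)
        (Icc_subset_Icc hd.le (le_add_of_nonneg_right hγs.le))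
  rcases hsc.eq_or_lt with h | h
  · rwa [← h]
  · obtain ⟨P, hP, hPs⟩ := hsS
    -- If `s < c`, a further cell tagged `s` would pass the supremum.
    have he : s < min c (s + γ s) := lt_min h (lt_add_of_pos_right s hγs)
    have := P.exists_snoc (t := s) (v := min c (s + γ s)) hP (hPs.symm ▸ he)
      (hPs.symm ▸ left_mem_Icc.2 he.le)
      (hPs.symm ▸ Icc_subset_Icc (sub_le_self s hγs.le) (min_le_right _ _))
    exact absurd (le_csSup hbdd (show min c (s + γ s) ∈ S from ⟨min_le_left _ _, this⟩)) he.not_ge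

end TaggedPartition

/-! ### Comparison of the two integrals -/

theorem mem_HK_iff {a : ℝ} {f : EReal → ℝ} (hf : f ∈ BV a) :
    f ∈ HK a ↔ ∃ A : ℝ, Tendsto (fun c : ℝ ↦ ∫ x in a..c, f (x : EReal)) atTop (𝓝 A) := by
  set V := (eVariationOn (fun x : ℝ ↦ f x) (Ici a)).toReal
  have hV : 0 ≤ V := ENNReal.toReal_nonneg
  -- A gauge at most `η` allows cells of length `2 * η`, hence the factor 2; `V + 1` avoids division
  -- by zero.
  have hη : ∀ {ε : ℝ}, 0 < ε → 0 < ε / (2 * (V + 1)) ∧ 2 * (ε / (2 * (V + 1))) * V ≤ ε := by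
    intro ε hε
    refine ⟨by positivity, ?_⟩
    have : 2 * (ε / (2 * (V + 1))) * V = ε * (V / (V + 1)) := by field_simp
    rw [this]
    exact mul_le_of_le_one_right hε.le (div_le_one_of_le₀ (by linarith) (by linarith))
  constructor
  · rintro ⟨A, hA⟩
    refine ⟨A, Metric.tendsto_atTop.2 fun ε hε ↦ ?_⟩
    obtain ⟨γ, hγ, hsum⟩ := hA (ε / 3) (by positivity)
    obtain ⟨hη₀, hηV⟩ := hη (ε := ε / 3) (by positivity)
    set η := ε / 3 / (2 * (V + 1))
    refine ⟨max a (1 / γ ⊤), fun c hc ↦ ?_⟩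
    -- One partition of `[a, c]`, fine for both `γ` and `η`, puts its Riemann sum near both `A` and
    -- the integral.
    obtain ⟨P, hP, hPc⟩ := TaggedPartition.exists_cellsFine (a := a)
      (γ := fun x ↦ min (γ x) η) ((le_max_left _ _).trans hc) fun x hx ↦
        lt_min (hγ x ⟨EReal.coe_le_coe_iff.2 hx, le_top⟩) hη₀
    have h1 := hsum P ⟨fun i hi ↦ (hP i hi).trans (Icc_subset_Icc
      (sub_le_sub_left (min_le_left _ _) _) (add_le_add_right (min_le_left _ _) _)),
      hPc.symm ▸ (le_max_right _ _).trans hc⟩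
    have h2 := P.abs_riemannSum_sub_integral_le hf (by positivity : 0 ≤ 2 * η)
      (hP.length_le fun x _ ↦ min_le_right _ _)
    rw [hPc] at h2
    rw [Real.dist_eq, abs_lt]
    have h3 := abs_le.1 h1
    have h4 := abs_le.1 (h2.trans hηV)
    constructor <;> linarith [h3.1, h3.2, h4.1, h4.2]
  · rintro ⟨A, hA⟩
    refine ⟨A, fun ε hε ↦ ?_⟩
    obtain ⟨N, hN⟩ := Metric.tendsto_atTop.1 hA (ε / 2) (by positivity)
    obtain ⟨hη₀, hηV⟩ := hη (ε := ε / 2) (by positivity)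
    set η := ε / 2 / (2 * (V + 1))
    -- The value at `⊤` forces the last point beyond `N`; the maximum with 1 keeps it positive.
    refine ⟨fun x ↦ if x = ⊤ then 1 / max N 1 else η, fun x _ ↦ ?_, fun P hP ↦ ?_⟩
    · dsimp only
      split_ifs <;> positivity
    · have hcells : P.CellsFine fun _ ↦ η := by simpa [TaggedPartition.CellsFine] using hP.1
      have h1 := P.abs_riemannSum_sub_integral_le hf (by positivity : 0 ≤ 2 * η)
        (hcells.length_le fun _ _ ↦ le_rfl)
      have h2 := hN (P.point P.n) ((le_max_left N 1).trans (by simpa using hP.2))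
      rw [Real.dist_eq] at h2
      have h3 := abs_le.1 (h1.trans hηV)
      have h4 := abs_lt.1 h2
      rw [abs_le]
      constructor <;> linarith [h3.1, h3.2, h4.1, h4.2]

theorem mem_LP_iff {a : ℝ} {f : EReal → ℝ} (hf : f ∈ BV a) :
    f ∈ LP a ↔ ∃ A : ℝ, Tendsto (fun c : ℝ ↦ ∫ x in a..c, f (x : EReal)) atTop (𝓝 A) := by
  have hi (c : ℝ) : IntegrableOn (fun x : ℝ ↦ f x) (Icc a c) :=
    integrableOn_of_boundedVariationOn (boundedVariationOn_comp_coe hf)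
  have heq : (fun c : ℝ ↦ integral (fun x : ℝ ↦ f x) a c) =ᶠ[atTop]
      fun c ↦ ∫ x in a..c, f (x : EReal) := by
    filter_upwards [eventually_ge_atTop a] with c hc
    exact integral_eq_of_integrableOn hc (hi c)
  refine ⟨fun ⟨_, A, hA⟩ ↦ ⟨A, hA.congr' heq⟩, fun ⟨A, hA⟩ ↦
    ⟨fun c hc ↦ integrableOnIcc_of_integrableOn hc (hi c), A, hA.congr' heq.symm⟩⟩

end LaplaceIntegral

theorem mainTheorem10 (a : ℝ) :
    LaplaceIntegral.LP a ∩ LaplaceIntegral.BV a =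
      LaplaceIntegral.HK a ∩ LaplaceIntegral.BV a := by
  ext f
  exact and_congr_left fun hf ↦
    (LaplaceIntegral.mem_LP_iff hf).trans (LaplaceIntegral.mem_HK_iff hf).symm
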